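/- **Setting.** Let $A\in\mathbb R^{n\times n}$, $B\in\mathbb R^{n\times m}$ with $(A,B)$ stabilizable ($A$ is not assumed invertible), let $Q\succ 0$, $R\succ 0$ be symmetric, and let $x_0\sim\mathcal D$ be a random vector in $\mathbb R^n$ with $\mathbb E[x_0]=0$, $\mathbb E[x_0x_0^\top]=\Sigma_0\succ 0$ and $\|x_0\|^2\le C_m$ a.s. for some $C_m>0$. Norms of matrices are spectral norms, $\kappa_X=\|X\|\|X^{-1}\|$, and $P^*\succ0$ denotes the positive definite solution of $$P=A^\top PA-A^\top PB(R+B^\top PB)^{-1}B^\top PA+Q .$$ Put $K^*=(R+B^\top P^*B)^{-1}B^\top P^*A$, $A_K^*=A-BK^*$, and $\|X\|_*^2=\sup_{z\ne0}\frac{z^\top X^\top P^*Xz}{z^\top P^*z}$. Fix a horizon $N\ge1$ and a terminal weight $Q_N$. For gains $K_{h+1},\dots,K_{N-1}$ and a gain $L$ at step $h\in\{0,\dots,N-1\}$, let $$J_h(L;K_{h+1},\dots,K_{N-1})=\mathbb E_{x_0\sim\mathcal D}\Big[x_0^\top(Q+L^\top RL)x_0+\sum_{t=h+1}^{N-1}x_{t-h}^\top(Q+K_t^\top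 RK_t)x_{t-h}+x_{N-h}^\top Q_Nx_{N-h}\Big],$$ where $x_1=(A-BL)x_0$ and $x_{t-h+1}=(A-BK_t)x_{t-h}$ for $t>h$. The gains $K_h^*$ are defined backward by $K_h^*=\operatorname{argmin}_LJ_h(L;K^*_{h+1},\dots,K^*_{N-1})$, and $P_N^*=Q_N$, $P_h^*=(A-BK_h^*)^\top P_{h+1}^*(A-BK_h^*)+(K_h^*)^\top RK_h^*+Q$. Given the gains $\widetilde K_{N-1},\dots,\widetilde K_0$ successively produced by the receding-horizon policy gradient (RHPG) algorithm, let $\widetilde K_h^*=\operatorname{argmin}_LJ_h(L;\widetilde K_{h+1},\dots,\widetilde K_{N-1})$ be the optimal gain for the LQR problem from step $h$ to $N$ incorporating the errors of the previous iterations. Let $$a=\tfrac12\sigma_{\min}(Q),\quad \varphi=\max_{0\le t\le N-1}\|A-BK_t^*\|,\quad C_1=\frac{\varphi\|B\|}{\lambda_{\min}(R)},$$ $$C_2=2\varphi\|A\|\Big(1+\frac{\|Q_N+aI\|\,\|B\|^2}{\lambda_{\min}(R)}\Big),\quad C_3=2\|R+B^\top(Q_N+aI)B\| .$$ **Theorem.**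 Let $\varepsilon>0$, let $Q_N\succeq P^*$, and suppose that $Q_N\succeq P_t^*$ for all $t\in\{1,\dots,N\}$ (that is, $\max_{1\le t\le N}P_t^*=P_N^*=Q_N$). Let $N\ge1$ be an integer with $$N\ \ge\ \frac12\cdot\frac{\log\left(\frac{2\|Q_N-P^*\|_*\,\kappa_{P^*}\,\|A_K^*\|\,\|B\|}{\varepsilon\,\lambda_{\min}(R)}\right)}{\log\left(\frac1{\|A_K^*\|_*}\right)}+1 ,$$ and suppose that for all $h\in\{0,\dots,N-1\}$ $$\|\widetilde K_h-\widetilde K_h^*\|\le\begin{cases}\min\left\{\sqrt{\frac{a}{C_3}},\ \sqrt{\frac{a}{C_2^{h-2}C_3}},\ \frac12\sqrt{\frac{\varepsilon}{C_1C_2^{h-1}C_3}}\right\}&h\ge2,\\[1ex]\min\left\{\sqrt{\frac a{C_3}},\ \frac12\sqrt{\frac{\varepsilon}{C_1C_3}}\right\}&h=1,\\[1ex]\frac\varepsilon4&h=0.\end{cases}$$ Then the output $\widetilde K_0$ satisfies $\|\widetilde K_0-K^*\|\le\varepsilon$. (In the degenerate cases $A=0$, $B=0$ or $Q_N=P^*$,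 in which some of these expressions are not defined, the conventions $x/0=0$ and $\log0=0$ are used.) -/

import Mathlib

open MeasureTheory
open scoped Matrix Matrix.Norms.L2Operator

noncomputable section

namespace LQR

/-- The data of a discrete-time LQR problem: system matrices `A`, `B`, stage weights `Q`, `R`, and
terminal weight `QN`. The norm `‖·‖` on matrices is the spectral (Euclidean operator) norm. -/
structure Data (n m : ℕ) where
  A : Matrix (Fin n) (Fin n) ℝ
  B : Matrix (Fin n) (Fin m) ℝ
  Q : Matrix (Fin n) (Fin n) ℝ
  R : Matrix (Fin m) (Fin m) ℝ
  QN : Matrix (Fin n) (Fin n) ℝ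

/-- Smallest eigenvalue (used for symmetric matrices). -/
def lambdaMin {k : ℕ} (X : Matrix (Fin k) (Fin k) ℝ) : ℝ := sInf (spectrum ℝ X)

/-- Smallest singular value of a square matrix. -/
def sigmaMin {k : ℕ} (X : Matrix (Fin k) (Fin k) ℝ) : ℝ := √(lambdaMin (Xᵀ * X))

/-- Condition number. -/
def cond {k : ℕ} (X : Matrix (Fin k) (Fin k) ℝ) : ℝ := ‖X‖ * ‖X⁻¹‖

/-- The `W`-induced norm: `‖X‖_W ^ 2 = sup_{z ≠ 0} (zᵀ Xᵀ W X z) / (zᵀ W z)`. -/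
def inducedNorm {k : ℕ} (W X : Matrix (Fin k) (Fin k) ℝ) : ℝ :=
  √(⨆ z : {z : Fin k → ℝ // z ≠ 0},
    (z.1 ⬝ᵥ ((Xᵀ * W * X) *ᵥ z.1)) / (z.1 ⬝ᵥ (W *ᵥ z.1)))

/-- `(A, B)` is stabilizable: some gain `K` makes all eigenvalues of `A - B K` lie in the open
unit disc. -/
def Stabilizable {n m : ℕ} (A : Matrix (Fin n) (Fin n) ℝ) (B : Matrix (Fin n) (Fin m) ℝ) : Prop :=
  ∃ K : Matrix (Fin m) (Fin n) ℝ,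
    ∀ z ∈ spectrum ℂ ((A - B * K).map (algebraMap ℝ ℂ)), ‖z‖ < 1

/-- Admissible distribution of the initial state: a probability law with mean zero, covariance
`Sigma0`, and squared Euclidean norm almost surely at most `Cm`. -/
structure IsInitialLaw {n : ℕ} (D : Measure (Fin n → ℝ)) (Sigma0 : Matrix (Fin n) (Fin n) ℝ)
    (Cm : ℝ) : Prop where
  isProb : IsProbabilityMeasure D
  mean_zero : ∀ i, ∫ x, x i ∂D = 0
  covariance : ∀ i j, ∫ x, x i * x j ∂D = Sigma0 i j
  bounded : ∀ᵐ x ∂D, x ⬝ᵥ x ≤ Cm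

namespace Data

variable {n m : ℕ} (S : Data n m)

/-- `P` solves the discrete-time algebraic Riccati equation. -/
def IsARESolution (P : Matrix (Fin n) (Fin n) ℝ) : Prop :=
  P = S.Aᵀ * P * S.A - S.Aᵀ * P * S.B * (S.R + S.Bᵀ * P * S.B)⁻¹ * S.Bᵀ * P * S.A + S.Q

/-- The gain `(R + Bᵀ P B)⁻¹ Bᵀ P A`; for `P` the positive definite solution of the Riccati
equation this is the infinite-horizon optimal gain `K*`. -/
def gain (P : Matrix (Fin n) (Fin n) ℝ) : Matrix (Fin m) (Fin n) ℝ :=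
  (S.R + S.Bᵀ * P * S.B)⁻¹ * S.Bᵀ * P * S.A

/-- State after `s` steps when started at `x₀` at time `h` under the feedback
`u_t = - K t x_t`. -/
def state (K : ℕ → Matrix (Fin m) (Fin n) ℝ) (h : ℕ) (x₀ : Fin n → ℝ) : ℕ → (Fin n → ℝ)
  | 0 => x₀
  | s + 1 => (S.A - S.B * K (h + s)) *ᵥ state K h x₀ s

/-- Cost accumulated from time `h` to the horizon `N` along the trajectory started at `x₀` at
time `h`, under the gains `K h, …, K (N - 1)` and with terminal weight `QN`. -/
def pathCost (N : ℕ) (K : ℕ → Matrix (Fin m) (Fin n) ℝ) (h : ℕ) (x₀ : Fin n → ℝ) : ℝ :=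
  (∑ s ∈ Finset.range (N - h),
      S.state K h x₀ s ⬝ᵥ ((S.Q + (K (h + s))ᵀ * S.R * K (h + s)) *ᵥ S.state K h x₀ s))
    + S.state K h x₀ (N - h) ⬝ᵥ (S.QN *ᵥ S.state K h x₀ (N - h))

/-- Expected finite-horizon cost from step `h` to `N` as a function of the gain `L` used at step
`h`, the gains `K t` at the later steps `t = h + 1, …, N - 1` being frozen. With `K = K*` this is
the true cost `J_h`, and with `K = K̃` the surrogate cost `J̃_h`. -/
def stageCost (D : Measure (Fin n → ℝ)) (N : ℕ) (K : ℕ → Matrix (Fin m) (Fin n) ℝ) (h : ℕ)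
    (L : Matrix (Fin m) (Fin n) ℝ) : ℝ :=
  ∫ x₀, S.pathCost N (Function.update K h L) h x₀ ∂D

/-- `L` minimizes the stage-`h` cost with the later gains frozen at `K t`, `h < t < N`. -/
def IsOptimalGain (D : Measure (Fin n → ℝ)) (N : ℕ) (K : ℕ → Matrix (Fin m) (Fin n) ℝ) (h : ℕ)
    (L : Matrix (Fin m) (Fin n) ℝ) : Prop :=
  IsMinOn (S.stageCost D N K h) Set.univ L

/-- `costToGo K t k` is the quadratic cost matrix at time `t` with `k` stages to go:
`P_t = (A - B K_t)ᵀ P_{t+1} (A - B K_t) + K_tᵀ R K_t + Q`, with `P = QN` at the horizon.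
For horizon `N` and `K = K*`, `costToGo K t (N - t)` is the Riccati iterate `P*_t`. -/
def costToGo (K : ℕ → Matrix (Fin m) (Fin n) ℝ) : ℕ → ℕ → Matrix (Fin n) (Fin n) ℝ
  | _, 0 => S.QN
  | t, k + 1 => (S.A - S.B * K t)ᵀ * costToGo K (t + 1) k * (S.A - S.B * K t)
      + (K t)ᵀ * S.R * K t + S.Q

/-- `a = σ_min(Q) / 2`. -/
def a : ℝ := sigmaMin S.Q / 2

/-- `φ = max_{0 ≤ t ≤ N - 1} ‖A - B K*_t‖`. -/
def phi (N : ℕ) (Kstar : ℕ → Matrix (Fin m) (Fin n) ℝ) : ℝ :=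
  ⨆ t : Fin N, ‖S.A - S.B * Kstar t‖

/-- `C₁ = φ ‖B‖ / λ_min(R)`. -/
def C₁ (N : ℕ) (Kstar : ℕ → Matrix (Fin m) (Fin n) ℝ) : ℝ :=
  S.phi N Kstar * ‖S.B‖ / lambdaMin S.R

/-- `C₂ = 2 φ ‖A‖ (1 + ‖Q_N + a I‖ ‖B‖² / λ_min(R))`. -/
def C₂ (N : ℕ) (Kstar : ℕ → Matrix (Fin m) (Fin n) ℝ) : ℝ :=
  2 * S.phi N Kstar * ‖S.A‖ * (1 + ‖S.QN + S.a • (1 : Matrix (Fin n) (Fin n) ℝ)‖ * ‖S.B‖ ^ 2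
    / lambdaMin S.R)

/-- `C₃ = 2 ‖R + Bᵀ (Q_N + a I) B‖`. -/
def C₃ : ℝ := 2 * ‖S.R + S.Bᵀ * (S.QN + S.a • (1 : Matrix (Fin n) (Fin n) ℝ)) * S.B‖

/-- The admissible error of the computed gain at stage `h`. In the last case the stage is
`h = k + 2`, so that the exponents `k` and `k + 1` are `h - 2` and `h - 1`. -/
def stageTol (N : ℕ) (Kstar : ℕ → Matrix (Fin m) (Fin n) ℝ) (ε : ℝ) : ℕ → ℝ
  | 0 => ε / 4
  | 1 => min √(S.a / S.C₃) (1 / 2 * √(ε / (S.C₁ N Kstar * S.C₃)))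
  | k + 2 => min √(S.a / S.C₃)
      (min √(S.a / (S.C₂ N Kstar ^ k * S.C₃))
        (1 / 2 * √(ε / (S.C₁ N Kstar * S.C₂ N Kstar ^ (k + 1) * S.C₃))))

/-- The horizon length
`1/2 · log(2 ‖Q_N - P‖_P κ_P ‖A_K‖ ‖B‖ / (ε λ_min(R))) / log(1 / ‖A_K‖_P) + 1`,
where `A_K = A - B K` with `K = gain P`. -/
def horizon (P : Matrix (Fin n) (Fin n) ℝ) (ε : ℝ) : ℝ :=
  1 / 2 * (Real.log (2 * inducedNorm P (S.QN - P) * cond P * ‖S.A - S.B * S.gain P‖ * ‖S.B‖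
      / (ε * lambdaMin S.R))
    / Real.log (1 / inducedNorm P (S.A - S.B * S.gain P))) + 1

end Data

end LQR

end

/-! Completing the square in the gain, together with positive definite covariance, shows that every
optimal gain is the Riccati gain `gain P` at the next cost-to-go matrix `P`
(`IsOptimalGain.eq_gain`). The error then splits through `gain P̃₁` and `gain P*₁` into three
pieces: the stage-0 error, at most ε/4 by assumption; a propagated part, at most ε/4; and a
finite-horizon part, at most ε/2. `norm_gain_sub_gain_le` reduces the last two to distances between
cost matrices.

For the horizon part, `P*_t - P*` stays positive semidefinite, and using the suboptimal gain `K*` at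
every step bounds it by a linear Lyapunov recursion with closed loop `A - B K*`. Since `Q ≻ 0`, this
loop is a strict contraction in the `P*`-norm, so the distance decays geometrically; the logarithmic
condition on `N` is this decay solved for `N`.

For the propagated part, `costStep_gain_sub` gives the exact identity that the difference of two
Riccati steps is `P - P'` between the two closed loops, and a gain error enters only quadratically.
Hence `e_h ≤ (C₂/2) e_{h+1} + (C₃/2) d_h²`, where `e_h` is the distance of the cost matrices and
`d_h` the stage error. The tolerances make each summand use half of the budget, which `error_bounds`
carries backward from `e_N = 0`. -/

namespace LQR

/-! ### Quadratic forms, spectral norm and smallest eigenvalue -/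

section QuadraticForms

variable {k l : ℕ}

theorem norm_toLp_sq (x : Fin k → ℝ) : ‖WithLp.toLp 2 x‖ ^ 2 = x ⬝ᵥ x := by
  rw [EuclideanSpace.real_norm_sq_eq]
  simp [dotProduct, sq]

theorem dotProduct_self_nonneg' (x : Fin k → ℝ) : 0 ≤ x ⬝ᵥ x := by
  rw [← norm_toLp_sq]; positivity

theorem norm_toLp_mulVec_le (X : Matrix (Fin k) (Fin l) ℝ) (x : Fin l → ℝ) :
    ‖WithLp.toLp 2 (X *ᵥ x)‖ ≤ ‖X‖ * ‖WithLp.toLp 2 x‖ :=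
  Matrix.l2_opNorm_mulVec X (WithLp.toLp 2 x)

theorem mulVec_dotProduct_self_le (X : Matrix (Fin k) (Fin l) ℝ) (x : Fin l → ℝ) :
    (X *ᵥ x) ⬝ᵥ (X *ᵥ x) ≤ ‖X‖ ^ 2 * (x ⬝ᵥ x) := by
  rw [← norm_toLp_sq, ← norm_toLp_sq, ← mul_pow]
  exact pow_le_pow_left₀ (norm_nonneg _) (norm_toLp_mulVec_le X x) 2

theorem norm_le_of_mulVec_dotProduct_self_le (X : Matrix (Fin k) (Fin l) ℝ) {c : ℝ} (hc : 0 ≤ c)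
    (h : ∀ x, (X *ᵥ x) ⬝ᵥ (X *ᵥ x) ≤ c ^ 2 * (x ⬝ᵥ x)) : ‖X‖ ≤ c := by
  rw [Matrix.l2_opNorm_def]
  refine ContinuousLinearMap.opNorm_le_bound _ hc fun x => ?_
  have hx := h x.ofLp
  rw [← norm_toLp_sq, ← norm_toLp_sq, ← mul_pow] at hx
  exact (sq_le_sq₀ (norm_nonneg _) (by positivity)).mp hx

theorem dotProduct_le_norm_mul_norm (x y : Fin k → ℝ) :
    x ⬝ᵥ y ≤ ‖WithLp.toLp 2 x‖ * ‖WithLp.toLp 2 y‖ := by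
  have := real_inner_le_norm (WithLp.toLp 2 y : EuclideanSpace ℝ (Fin k)) (WithLp.toLp 2 x)
  rw [mul_comm]
  simpa [EuclideanSpace.inner_eq_star_dotProduct] using this

theorem dotProduct_mulVec_le (X : Matrix (Fin k) (Fin k) ℝ) (x : Fin k → ℝ) :
    x ⬝ᵥ (X *ᵥ x) ≤ ‖X‖ * (x ⬝ᵥ x) := by
  rw [← norm_toLp_sq]
  nlinarith [dotProduct_le_norm_mul_norm x (X *ᵥ x), norm_toLp_mulVec_le X x,
    norm_nonneg (WithLp.toLp 2 x : EuclideanSpace ℝ (Fin k))]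

theorem dotProduct_congr_mulVec (X : Matrix (Fin k) (Fin k) ℝ) (Y : Matrix (Fin k) (Fin l) ℝ)
    (x : Fin l → ℝ) : x ⬝ᵥ ((Yᵀ * X * Y) *ᵥ x) = (Y *ᵥ x) ⬝ᵥ (X *ᵥ (Y *ᵥ x)) := by
  rw [Matrix.mul_assoc, ← Matrix.mulVec_mulVec, ← Matrix.mulVec_mulVec, Matrix.dotProduct_mulVec,
    Matrix.vecMul_transpose]

theorem dotProduct_transpose_mul_self_mulVec (Y : Matrix (Fin k) (Fin l) ℝ) (x : Fin l → ℝ) :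
    x ⬝ᵥ ((Yᵀ * Y) *ᵥ x) = (Y *ᵥ x) ⬝ᵥ (Y *ᵥ x) := by
  rw [← Matrix.mulVec_mulVec, Matrix.dotProduct_mulVec, Matrix.vecMul_transpose]

theorem norm_transpose (X : Matrix (Fin k) (Fin l) ℝ) : ‖Xᵀ‖ = ‖X‖ := by
  rw [← Matrix.conjTranspose_eq_transpose_of_trivial, Matrix.l2_opNorm_conjTranspose]

theorem norm_transpose_mul_self (X : Matrix (Fin k) (Fin l) ℝ) : ‖Xᵀ * X‖ = ‖X‖ ^ 2 := by
  rw [← Matrix.conjTranspose_eq_transpose_of_trivial, Matrix.l2_opNorm_conjTranspose_mul_self, sq]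

theorem PosSemidef.nonneg {X : Matrix (Fin k) (Fin k) ℝ} (hX : X.PosSemidef) (x : Fin k → ℝ) :
    0 ≤ x ⬝ᵥ (X *ᵥ x) := by
  simpa using hX.dotProduct_mulVec_nonneg x

theorem PosSemidef.dotProduct_le {X Y : Matrix (Fin k) (Fin k) ℝ} (h : (Y - X).PosSemidef)
    (x : Fin k → ℝ) : x ⬝ᵥ (X *ᵥ x) ≤ x ⬝ᵥ (Y *ᵥ x) := by
  have := PosSemidef.nonneg h x
  rwa [Matrix.sub_mulVec, dotProduct_sub, sub_nonneg] at this

theorem PosSemidef.exists_transpose_mul_self {X : Matrix (Fin k) (Fin k) ℝ} (hX : X.PosSemidef) :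
    ∃ Y : Matrix (Fin k) (Fin k) ℝ, X = Yᵀ * Y := by
  open scoped MatrixOrder in
  obtain ⟨Y, hY⟩ := CStarAlgebra.nonneg_iff_eq_star_mul_self.mp hX.nonneg
  exact ⟨Y, by rw [hY, Matrix.star_eq_conjTranspose, Matrix.conjTranspose_eq_transpose_of_trivial]⟩

/-- Factor `X = YᵀY`: the form is `|Yx|²`, and the C*-identity gives `‖X‖ = ‖Y‖²`. -/
theorem PosSemidef.norm_le {X : Matrix (Fin k) (Fin k) ℝ} (hX : X.PosSemidef) {c : ℝ} (hc : 0 ≤ c)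
    (h : ∀ x, x ⬝ᵥ (X *ᵥ x) ≤ c * (x ⬝ᵥ x)) : ‖X‖ ≤ c := by
  obtain ⟨Y, rfl⟩ := PosSemidef.exists_transpose_mul_self hX
  rw [norm_transpose_mul_self, ← Real.sq_sqrt hc]
  refine pow_le_pow_left₀ (norm_nonneg _) ?_ 2
  refine norm_le_of_mulVec_dotProduct_self_le Y (Real.sqrt_nonneg c) fun x => ?_
  rw [Real.sq_sqrt hc, ← dotProduct_transpose_mul_self_mulVec]
  exact h x

theorem PosSemidef.norm_le_norm {X Y : Matrix (Fin k) (Fin k) ℝ} (hX : X.PosSemidef)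
    (h : ∀ x, x ⬝ᵥ (X *ᵥ x) ≤ x ⬝ᵥ (Y *ᵥ x)) : ‖X‖ ≤ ‖Y‖ :=
  PosSemidef.norm_le hX (norm_nonneg _) fun x => (h x).trans (dotProduct_mulVec_le Y x)

/-- With `W = YᵀY` and `Y` invertible, write `x = Y⁻¹(Yx)` and use `‖W⁻¹‖ = ‖Y⁻¹‖²`. -/
theorem PosDef.dotProduct_self_le {W : Matrix (Fin k) (Fin k) ℝ} (hW : W.PosDef) (x : Fin k → ℝ) :
    x ⬝ᵥ x ≤ ‖W⁻¹‖ * (x ⬝ᵥ (W *ᵥ x)) := by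
  obtain ⟨Y, rfl⟩ := PosSemidef.exists_transpose_mul_self hW.posSemidef
  have hdet : IsUnit Y.det := by
    have := (Matrix.isUnit_iff_isUnit_det _).mp hW.isUnit
    rw [Matrix.det_mul] at this
    exact isUnit_of_mul_isUnit_right this
  have hn : ‖(Yᵀ * Y)⁻¹‖ = ‖Y⁻¹‖ ^ 2 := by
    rw [Matrix.mul_inv_rev, ← Matrix.transpose_nonsing_inv]
    conv_lhs => enter [1, 1]; rw [← Matrix.transpose_transpose Y⁻¹]
    rw [norm_transpose_mul_self, norm_transpose]
  rw [hn, dotProduct_transpose_mul_self_mulVec]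
  have := mulVec_dotProduct_self_le Y⁻¹ (Y *ᵥ x)
  rwa [Matrix.mulVec_mulVec, Matrix.nonsing_inv_mul _ hdet, Matrix.one_mulVec] at this

/-- The size must be nonzero: for an empty matrix the spectrum is empty and its `sInf` is 0. -/
theorem lambdaMin_pos [NeZero k] {R : Matrix (Fin k) (Fin k) ℝ} (hR : R.PosDef) :
    0 < lambdaMin R := by
  have hne : (spectrum ℝ R).Nonempty := ⟨_, hR.isHermitian.eigenvalues_mem_spectrum_real 0⟩
  have hmem : lambdaMin R ∈ spectrum ℝ R := hne.csInf_mem R.finite_real_spectrum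
  rw [hR.isHermitian.spectrum_real_eq_range_eigenvalues] at hmem
  obtain ⟨i, hi⟩ := hmem
  rw [← hi]
  exact hR.eigenvalues_pos i

theorem lambdaMin_mul_le {R : Matrix (Fin k) (Fin k) ℝ} (hR : R.IsHermitian) (x : Fin k → ℝ) :
    lambdaMin R * (x ⬝ᵥ x) ≤ x ⬝ᵥ (R *ᵥ x) := by
  have h : (R - algebraMap ℝ _ (lambdaMin R)).PosSemidef := by
    refine Matrix.posSemidef_iff_isHermitian_and_spectrum_nonneg.mpr ⟨?_, ?_⟩
    · refine hR.sub ?_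
      rw [Algebra.algebraMap_eq_smul_one]
      simp [Matrix.IsHermitian]
    · intro t ht
      rw [← spectrum.sub_singleton_eq] at ht
      obtain ⟨s, hs, c, hc, rfl⟩ := ht
      rw [Set.mem_singleton_iff] at hc
      subst hc
      exact sub_nonneg.mpr (csInf_le R.finite_real_spectrum.bddBelow hs)
  have := PosSemidef.nonneg h x
  rw [Matrix.sub_mulVec, dotProduct_sub, Algebra.algebraMap_eq_smul_one, Matrix.smul_mulVec,
    Matrix.one_mulVec, dotProduct_smul, smul_eq_mul] at this
  linarith

theorem norm_inv_le_of_coercive {M : Matrix (Fin k) (Fin k) ℝ} {c : ℝ} (hc : 0 < c)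
    (hM : IsUnit M.det) (h : ∀ x, c * (x ⬝ᵥ x) ≤ x ⬝ᵥ (M *ᵥ x)) : ‖M⁻¹‖ ≤ c⁻¹ := by
  refine norm_le_of_mulVec_dotProduct_self_le _ (inv_nonneg.mpr hc.le) fun x => ?_
  have h1 := h (M⁻¹ *ᵥ x)
  rw [Matrix.mulVec_mulVec, Matrix.mul_nonsing_inv _ hM, Matrix.one_mulVec] at h1
  set y := M⁻¹ *ᵥ x
  -- Expanding `|x - c y|² ≥ 0` and inserting `c|y|² ≤ y·x` gives `c²|y|² ≤ |x|²`; symmetry of `M`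
  -- plays no role.
  have h2 := dotProduct_self_nonneg' (x - c • y)
  simp only [sub_dotProduct, dotProduct_sub, smul_dotProduct, dotProduct_smul, smul_eq_mul,
    dotProduct_comm x y] at h2
  rw [inv_pow, ← div_eq_inv_mul, le_div_iff₀ (by positivity)]
  nlinarith

end QuadraticForms

/-! ### The norm induced by a positive definite weight -/

section InducedNorm

variable {k : ℕ} {W : Matrix (Fin k) (Fin k) ℝ}

theorem inducedNorm_nonneg (W X : Matrix (Fin k) (Fin k) ℝ) : 0 ≤ inducedNorm W X :=
  Real.sqrt_nonneg _

theorem inducedNorm_sq (hW : W.PosDef) (X : Matrix (Fin k) (Fin k) ℝ) :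
    inducedNorm W X ^ 2 = ⨆ z : {z : Fin k → ℝ // z ≠ 0},
      (z.1 ⬝ᵥ ((Xᵀ * W * X) *ᵥ z.1)) / (z.1 ⬝ᵥ (W *ᵥ z.1)) := by
  refine Real.sq_sqrt (Real.iSup_nonneg fun z => ?_)
  rw [dotProduct_congr_mulVec]
  exact div_nonneg (PosSemidef.nonneg hW.posSemidef _) (PosSemidef.nonneg hW.posSemidef _)

theorem PosDef.pos (hW : W.PosDef) {z : Fin k → ℝ} (hz : z ≠ 0) : 0 < z ⬝ᵥ (W *ᵥ z) := by
  simpa using hW.dotProduct_mulVec_pos hz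

theorem dotProduct_mulVec_le_inducedNorm (hW : W.PosDef) (X : Matrix (Fin k) (Fin k) ℝ)
    (z : Fin k → ℝ) :
    (X *ᵥ z) ⬝ᵥ (W *ᵥ (X *ᵥ z)) ≤ inducedNorm W X ^ 2 * (z ⬝ᵥ (W *ᵥ z)) := by
  by_cases hz : z = 0
  · simp [hz]
  rw [← dotProduct_congr_mulVec, ← div_le_iff₀ (PosDef.pos hW hz), inducedNorm_sq hW]
  refine le_ciSup (f := fun z : {z : Fin k → ℝ // z ≠ 0} =>
      (z.1 ⬝ᵥ ((Xᵀ * W * X) *ᵥ z.1)) / (z.1 ⬝ᵥ (W *ᵥ z.1))) ?_ ⟨z, hz⟩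
  -- A real supremum is an upper bound only for a bounded family; this constant bounds the Rayleigh
  -- quotients.
  refine ⟨‖Xᵀ * W * X‖ * ‖W⁻¹‖, ?_⟩
  rintro _ ⟨⟨y, hy⟩, rfl⟩
  dsimp only
  rw [div_le_iff₀ (PosDef.pos hW hy), mul_assoc ‖_‖]
  exact (dotProduct_mulVec_le _ y).trans
    (mul_le_mul_of_nonneg_left (PosDef.dotProduct_self_le hW y) (norm_nonneg _))

theorem pow_mulVec_le_inducedNorm (hW : W.PosDef) (X : Matrix (Fin k) (Fin k) ℝ) (j : ℕ)
    (z : Fin k → ℝ) :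
    ((X ^ j) *ᵥ z) ⬝ᵥ (W *ᵥ ((X ^ j) *ᵥ z)) ≤ inducedNorm W X ^ (2 * j) * (z ⬝ᵥ (W *ᵥ z)) := by
  induction j with
  | zero => simp
  | succ j ih =>
    rw [pow_succ' X, ← Matrix.mulVec_mulVec]
    refine (dotProduct_mulVec_le_inducedNorm hW X _).trans ?_
    rw [show 2 * (j + 1) = 2 + 2 * j by ring, pow_add, mul_assoc]
    exact mul_le_mul_of_nonneg_left ih (sq_nonneg _)

theorem inducedNorm_lt_one (hW : W.PosDef) {X Q : Matrix (Fin k) (Fin k) ℝ} (hQ : Q.PosDef)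
    (h : ∀ z, (X *ᵥ z) ⬝ᵥ (W *ᵥ (X *ᵥ z)) ≤ z ⬝ᵥ (W *ᵥ z) - z ⬝ᵥ (Q *ᵥ z)) :
    inducedNorm W X < 1 := by
  -- `b⁻¹ W ⪯ Q` turns the decrease into a contraction factor; the added 1 gives `b ≥ 1` even in
  -- dimension zero.
  set b := ‖W‖ * ‖Q⁻¹‖ + 1 with hb
  have hb1 : 1 ≤ b := by
    have : 0 ≤ ‖W‖ * ‖Q⁻¹‖ := by positivity
    linarith
  have hsq : inducedNorm W X ^ 2 ≤ 1 - b⁻¹ := by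
    rw [inducedNorm_sq hW]
    refine Real.iSup_le (fun ⟨z, hz⟩ => ?_) (sub_nonneg.mpr (inv_le_one_of_one_le₀ hb1))
    dsimp only
    rw [dotProduct_congr_mulVec, div_le_iff₀ (PosDef.pos hW hz)]
    have h1 := h z
    have h2 := dotProduct_mulVec_le W z
    have h3 := mul_le_mul_of_nonneg_left (PosDef.dotProduct_self_le hQ z) (norm_nonneg W)
    have h4 := PosSemidef.nonneg hQ.posSemidef z
    have h5 : b⁻¹ * (z ⬝ᵥ (W *ᵥ z)) ≤ z ⬝ᵥ (Q *ᵥ z) := by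
      rw [inv_mul_le_iff₀ (by linarith)]
      nlinarith
    linarith
  have : 0 < b⁻¹ := by positivity
  nlinarith [inducedNorm_nonneg W X]

/-- A form `z ↦ zᵀ M z` is bounded by the `W`-induced norm of `M` up to the smallest eigenvalue
of `W`. -/
theorem dotProduct_mulVec_le_inducedNorm_mul (hW : W.PosDef) (M : Matrix (Fin k) (Fin k) ℝ)
    (y : Fin k → ℝ) :
    y ⬝ᵥ (M *ᵥ y) ≤ inducedNorm W M * ‖W⁻¹‖ * (y ⬝ᵥ (W *ᵥ y)) := by
  have h0 := PosSemidef.nonneg hW.posSemidef y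
  have h1 : (M *ᵥ y) ⬝ᵥ (M *ᵥ y) ≤ ‖W⁻¹‖ * (inducedNorm W M ^ 2 * (y ⬝ᵥ (W *ᵥ y))) :=
    (PosDef.dotProduct_self_le hW _).trans
      (mul_le_mul_of_nonneg_left (dotProduct_mulVec_le_inducedNorm hW M y) (norm_nonneg _))
  have h2 := PosDef.dotProduct_self_le hW y
  have h3 := dotProduct_le_norm_mul_norm y (M *ᵥ y)
  have h4 := inducedNorm_nonneg W M
  refine h3.trans ((sq_le_sq₀ (by positivity) (by positivity)).mp ?_)
  rw [mul_pow, norm_toLp_sq, norm_toLp_sq]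
  calc y ⬝ᵥ y * (M *ᵥ y ⬝ᵥ M *ᵥ y)
      ≤ (‖W⁻¹‖ * (y ⬝ᵥ (W *ᵥ y))) * (‖W⁻¹‖ * (inducedNorm W M ^ 2 * (y ⬝ᵥ (W *ᵥ y)))) :=
        mul_le_mul h2 h1 (dotProduct_self_nonneg' _) (by positivity)
    _ = _ := by ring

end InducedNorm


namespace Data

variable {n m : ℕ} (S : Data n m)

/-- One step of the cost recursion under the gain `L`. -/
def costStep (P : Matrix (Fin n) (Fin n) ℝ) (L : Matrix (Fin m) (Fin n) ℝ) :
    Matrix (Fin n) (Fin n) ℝ :=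
  (S.A - S.B * L)ᵀ * P * (S.A - S.B * L) + Lᵀ * S.R * L + S.Q

/-- The Hessian `R + Bᵀ P B` of the one-step cost. -/
def hess (P : Matrix (Fin n) (Fin n) ℝ) : Matrix (Fin m) (Fin m) ℝ := S.R + S.Bᵀ * P * S.B

/-! ### Algebra of the Riccati step -/

section Riccati

variable {S} {P P' : Matrix (Fin n) (Fin n) ℝ}

theorem PosSemidef.transpose_mul_mul_same {k l : ℕ} {X : Matrix (Fin k) (Fin k) ℝ}
    (hX : X.PosSemidef) (Y : Matrix (Fin k) (Fin l) ℝ) : (Yᵀ * X * Y).PosSemidef := by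
  simpa using hX.conjTranspose_mul_mul_same Y

theorem PosSemidef.transpose_eq {k : ℕ} {X : Matrix (Fin k) (Fin k) ℝ}
    (hX : X.PosSemidef) : Xᵀ = X := by
  simpa [Matrix.IsHermitian] using hX.isHermitian

theorem hess_posDef (hR : S.R.PosDef) (hP : P.PosSemidef) : (S.hess P).PosDef :=
  hR.add_posSemidef (PosSemidef.transpose_mul_mul_same hP S.B)

theorem hess_isUnit_det (hR : S.R.PosDef) (hP : P.PosSemidef) : IsUnit (S.hess P).det :=
  (Matrix.isUnit_iff_isUnit_det _).mp (hess_posDef hR hP).isUnit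

theorem hess_mul_gain (hR : S.R.PosDef) (hP : P.PosSemidef) :
    S.hess P * S.gain P = S.Bᵀ * P * S.A := by
  have h := Matrix.mul_nonsing_inv _ (hess_isUnit_det hR hP)
  unfold gain
  rw [← hess, ← Matrix.mul_assoc, ← Matrix.mul_assoc, ← Matrix.mul_assoc, h, Matrix.one_mul]

/-- The stationarity condition `R K = Bᵀ P (A - B K)`, expanded as a rewrite rule that eliminates
`R`. -/
theorem R_mul_gain (hR : S.R.PosDef) (hP : P.PosSemidef) :
    S.R * S.gain P = S.Bᵀ * (P * S.A) - S.Bᵀ * (P * (S.B * S.gain P)) := by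
  have h := hess_mul_gain hR hP
  rw [hess, Matrix.add_mul] at h
  simp only [Matrix.mul_assoc] at h
  exact eq_sub_of_add_eq h

theorem gain_transpose_mul_R (hR : S.R.PosDef) (hP : P.PosSemidef)
    (L : Matrix (Fin m) (Fin n) ℝ) : (S.gain P)ᵀ * (S.R * L) =
      S.Aᵀ * (P * (S.B * L)) - (S.gain P)ᵀ * (S.Bᵀ * (P * (S.B * L))) := by
  have h := congrArg Matrix.transpose (R_mul_gain hR hP)
  simp only [Matrix.transpose_mul, Matrix.transpose_sub, Matrix.transpose_transpose,
    PosSemidef.transpose_eq hP, PosSemidef.transpose_eq hR.posSemidef] at h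
  rw [← Matrix.mul_assoc, h, Matrix.sub_mul]
  simp only [Matrix.mul_assoc]

/-- Stationarity makes the right-hand side independent of `L`, so the gain in the right factors is
free. -/
theorem costStep_gain (hR : S.R.PosDef) (hP : P.PosSemidef) (L : Matrix (Fin m) (Fin n) ℝ) :
    S.costStep P (S.gain P) =
      (S.A - S.B * S.gain P)ᵀ * P * (S.A - S.B * L) + (S.gain P)ᵀ * S.R * L + S.Q := by
  simp only [costStep, Matrix.mul_assoc, gain_transpose_mul_R hR hP, Matrix.mul_sub,
    Matrix.sub_mul, Matrix.transpose_sub, Matrix.transpose_mul]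
  abel

/-- Evaluate the step from `P` with right gain `gain P'`, and the transposed step from `P'` with
left gain `gain P`. The terms in `R` and `Q` then cancel, leaving no second-order remainder. -/
theorem costStep_gain_sub (hR : S.R.PosDef) (hP : P.PosSemidef) (hP' : P'.PosSemidef) :
    S.costStep P (S.gain P) - S.costStep P' (S.gain P') =
      (S.A - S.B * S.gain P)ᵀ * (P - P') * (S.A - S.B * S.gain P') := by
  have h' : S.costStep P' (S.gain P') =
      (S.A - S.B * S.gain P)ᵀ * P' * (S.A - S.B * S.gain P')
        + (S.gain P)ᵀ * S.R * S.gain P' + S.Q := by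
    have h := congrArg Matrix.transpose (costStep_gain hR hP' (S.gain P))
    -- Symmetry of `Q` is not among the hypotheses, so `Q` is subtracted before transposing.
    have hc : (S.costStep P' (S.gain P'))ᵀ - S.Qᵀ = S.costStep P' (S.gain P') - S.Q := by
      simp [costStep, Matrix.transpose_mul, PosSemidef.transpose_eq hP',
        PosSemidef.transpose_eq hR.posSemidef, Matrix.mul_assoc]
    rw [← sub_left_inj (a := S.Q), ← hc, h]
    simp [Matrix.transpose_mul, PosSemidef.transpose_eq hP',
        PosSemidef.transpose_eq hR.posSemidef, Matrix.mul_assoc]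
  rw [costStep_gain hR hP (S.gain P'), h', Matrix.mul_sub _ P P', Matrix.sub_mul _ _ (S.A - _)]
  abel

theorem gain_transpose_mul (hR : S.R.PosDef) (hP : P.PosSemidef) :
    (S.gain P)ᵀ * (S.Bᵀ * (P * S.A)) = S.Aᵀ * (P * (S.B * S.gain P)) := by
  have h := congrArg Matrix.transpose (hess_mul_gain hR hP)
  simp only [Matrix.transpose_mul, Matrix.transpose_transpose, PosSemidef.transpose_eq hP,
    PosSemidef.transpose_eq (hess_posDef hR hP).posSemidef] at h
  have h2 := hess_mul_gain hR hP
  rw [← Matrix.mul_assoc S.Bᵀ, ← h2, ← Matrix.mul_assoc, h]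
  simp only [Matrix.mul_assoc]

/-- Completion of the square: no linear term survives at the stationary gain. -/
theorem costStep_sub_costStep_gain (hR : S.R.PosDef) (hP : P.PosSemidef)
    (L : Matrix (Fin m) (Fin n) ℝ) :
    S.costStep P L - S.costStep P (S.gain P) = (L - S.gain P)ᵀ * S.hess P * (L - S.gain P) := by
  simp only [costStep, hess, Matrix.mul_assoc, gain_transpose_mul_R hR hP, R_mul_gain hR hP,
    gain_transpose_mul hR hP, Matrix.mul_sub, Matrix.sub_mul, Matrix.mul_add, Matrix.add_mul, Matrix.transpose_sub,
    Matrix.transpose_mul]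
  abel

theorem costStep_sub_costStep (L : Matrix (Fin m) (Fin n) ℝ) :
    S.costStep P L - S.costStep P' L = (S.A - S.B * L)ᵀ * (P - P') * (S.A - S.B * L) := by
  rw [costStep, costStep, Matrix.mul_sub _ P P', Matrix.sub_mul _ _ (S.A - _)]
  abel

theorem gain_sub_gain (hR : S.R.PosDef) (hP : P.PosSemidef) (hP' : P'.PosSemidef) :
    S.gain P - S.gain P' =
      (S.hess P)⁻¹ * (S.Bᵀ * (P - P') * (S.A - S.B * S.gain P')) := by
  have h : S.hess P * (S.gain P - S.gain P') =
      S.Bᵀ * (P - P') * (S.A - S.B * S.gain P') := by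
    rw [Matrix.mul_sub, hess_mul_gain hR hP, hess, Matrix.add_mul, R_mul_gain hR hP']
    simp only [Matrix.mul_assoc, Matrix.mul_sub, Matrix.sub_mul]
    abel
  rw [← h, ← Matrix.mul_assoc, Matrix.nonsing_inv_mul _ (hess_isUnit_det hR hP), Matrix.one_mul]

/-- Factoring `A` out on the right produces the factor `‖A‖` in `C₂` without inverting `A`. -/
theorem sub_mul_gain (P : Matrix (Fin n) (Fin n) ℝ) :
    S.A - S.B * S.gain P = (1 - S.B * (S.hess P)⁻¹ * S.Bᵀ * P) * S.A := by
  rw [gain, ← hess, Matrix.sub_mul, Matrix.one_mul]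
  simp only [Matrix.mul_assoc]

theorem IsARESolution.costStep_eq (hR : S.R.PosDef) (hP : P.PosSemidef)
    (h : S.IsARESolution P) : S.costStep P (S.gain P) = P := by
  -- The free gain is set to 0, leaving `(A - B K)ᵀ P A + Q`, the right-hand side of the Riccati
  -- equation.
  rw [costStep_gain hR hP 0]
  conv_rhs => rw [h]
  simp only [Matrix.mul_zero, sub_zero, add_zero, Matrix.transpose_sub, Matrix.sub_mul,
    Matrix.transpose_mul, Matrix.mul_assoc,
    gain_transpose_mul hR hP]
  simp only [gain, Matrix.mul_assoc]

theorem costStep_posSemidef (hQ : S.Q.PosSemidef) (hR : S.R.PosSemidef) (hP : P.PosSemidef)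
    (L : Matrix (Fin m) (Fin n) ℝ) : (S.costStep P L).PosSemidef :=
  ((PosSemidef.transpose_mul_mul_same hP _).add (PosSemidef.transpose_mul_mul_same hR _)).add hQ

theorem costToGo_posSemidef (hQ : S.Q.PosSemidef) (hR : S.R.PosSemidef) (hN : S.QN.PosSemidef)
    (K : ℕ → Matrix (Fin m) (Fin n) ℝ) (t k : ℕ) : (S.costToGo K t k).PosSemidef := by
  induction k generalizing t with
  | zero => exact hN
  | succ k ih => exact costStep_posSemidef hQ hR (ih (t + 1)) (K t)

theorem costStep_mono (h : (P - P').PosSemidef) (L : Matrix (Fin m) (Fin n) ℝ) :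
    (S.costStep P L - S.costStep P' L).PosSemidef := by
  rw [costStep_sub_costStep]
  exact PosSemidef.transpose_mul_mul_same h _

theorem costStep_gain_le (hR : S.R.PosDef) (hP : P.PosSemidef) (L : Matrix (Fin m) (Fin n) ℝ) :
    (S.costStep P L - S.costStep P (S.gain P)).PosSemidef := by
  rw [costStep_sub_costStep_gain hR hP]
  exact PosSemidef.transpose_mul_mul_same (hess_posDef hR hP).posSemidef _

/-- Compare through the step from `P'` with `gain P`: monotone in the cost matrix, and suboptimal
for `P'`. -/
theorem costStep_gain_mono (hR : S.R.PosDef) (hP' : P'.PosSemidef)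
    (h : (P - P').PosSemidef) :
    (S.costStep P (S.gain P) - S.costStep P' (S.gain P')).PosSemidef := by
  have := (costStep_mono (S := S) h (S.gain P)).add (costStep_gain_le hR hP' (S.gain P))
  rwa [sub_add_sub_cancel] at this

end Riccati

/-! ### Trajectory cost as a quadratic form -/

section Cost

theorem costToGo_congr {K K' : ℕ → Matrix (Fin m) (Fin n) ℝ} {h : ℕ}
    (hK : ∀ t, h ≤ t → K t = K' t) (k : ℕ) : S.costToGo K h k = S.costToGo K' h k := by
  induction k generalizing h with
  | zero => rfl
  | succ k ih => rw [costToGo, costToGo, ih fun t ht => hK t (by omega), hK h le_rfl]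

theorem state_succ' (K : ℕ → Matrix (Fin m) (Fin n) ℝ) (h : ℕ) (x : Fin n → ℝ) (s : ℕ) :
    S.state K h x (s + 1) = S.state K (h + 1) ((S.A - S.B * K h) *ᵥ x) s := by
  induction s with
  | zero => rfl
  | succ s ih =>
    rw [state, ih, state]
    congr 4
    omega

theorem sum_state_eq_costToGo (K : ℕ → Matrix (Fin m) (Fin n) ℝ) (h k : ℕ) (x : Fin n → ℝ) :
    (∑ s ∈ Finset.range k,
      S.state K h x s ⬝ᵥ ((S.Q + (K (h + s))ᵀ * S.R * K (h + s)) *ᵥ S.state K h x s))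
    + S.state K h x k ⬝ᵥ (S.QN *ᵥ S.state K h x k) = x ⬝ᵥ (S.costToGo K h k *ᵥ x) := by
  induction k generalizing h x with
  | zero => simp [state, costToGo]
  | succ k ih =>
    have hrec : x ⬝ᵥ (S.costToGo K h (k + 1) *ᵥ x) =
        ((S.A - S.B * K h) *ᵥ x) ⬝ᵥ (S.costToGo K (h + 1) k *ᵥ ((S.A - S.B * K h) *ᵥ x))
          + x ⬝ᵥ (((K h)ᵀ * S.R * K h) *ᵥ x) + x ⬝ᵥ (S.Q *ᵥ x) := by
      rw [← dotProduct_congr_mulVec (S.costToGo K (h + 1) k), ← dotProduct_add,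
        ← Matrix.add_mulVec, ← dotProduct_add, ← Matrix.add_mulVec, costToGo]
    rw [hrec, Finset.sum_range_succ', state_succ', ← ih (h + 1)]
    have hzero : S.state K h x 0 = x := rfl
    simp only [state_succ', hzero, add_zero, Matrix.add_mulVec, dotProduct_add,
      show ∀ s, h + 1 + s = h + (s + 1) by intro s; omega]
    ring

theorem pathCost_update {N h : ℕ} (hh : h < N) (K : ℕ → Matrix (Fin m) (Fin n) ℝ)
    (L : Matrix (Fin m) (Fin n) ℝ) (x : Fin n → ℝ) :
    S.pathCost N (Function.update K h L) h x =
      x ⬝ᵥ (S.costStep (S.costToGo K (h + 1) (N - (h + 1))) L *ᵥ x) := by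
  rw [pathCost, sum_state_eq_costToGo]
  obtain ⟨k, rfl⟩ : ∃ k, N = h + 1 + k := ⟨N - (h + 1), by omega⟩
  rw [show h + 1 + k - h = k + 1 by omega, show h + 1 + k - (h + 1) = k by omega, costToGo,
    costStep, Function.update_self,
    S.costToGo_congr (K := Function.update K h L) (K' := K)
      fun t ht => Function.update_of_ne (by omega) _ _]

end Cost

/-! ### Minimizers of the expected cost -/

section Optimality

variable {S} {D : Measure (Fin n → ℝ)} {Sigma0 : Matrix (Fin n) (Fin n) ℝ} {Cm : ℝ}

theorem sq_apply_le (x : Fin n → ℝ) (i : Fin n) : x i ^ 2 ≤ x ⬝ᵥ x := by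
  rw [sq]
  exact Finset.single_le_sum (f := fun j => x j * x j) (fun j _ => mul_self_nonneg _)
    (Finset.mem_univ i)

theorem IsInitialLaw.integrable_mul (hD : IsInitialLaw D Sigma0 Cm) (i j : Fin n) :
    Integrable (fun x : Fin n → ℝ => x i * x j) D := by
  have := hD.isProb
  refine Integrable.of_bound (C := Cm) (by fun_prop) ?_
  filter_upwards [hD.bounded] with x hx
  rw [Real.norm_eq_abs, abs_le]
  have hi := sq_apply_le x i
  have hj := sq_apply_le x j
  constructor <;> nlinarith [sq_nonneg (x i + x j), sq_nonneg (x i - x j)]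

theorem dotProduct_mulVec_eq_sum (X : Matrix (Fin n) (Fin n) ℝ) (x : Fin n → ℝ) :
    x ⬝ᵥ (X *ᵥ x) = ∑ i, ∑ j, X i j * (x i * x j) := by
  simp only [dotProduct, Matrix.mulVec, Finset.mul_sum]
  exact Finset.sum_congr rfl fun i _ => Finset.sum_congr rfl fun j _ => by ring

theorem IsInitialLaw.integrable_form (hD : IsInitialLaw D Sigma0 Cm)
    (X : Matrix (Fin n) (Fin n) ℝ) : Integrable (fun x => x ⬝ᵥ (X *ᵥ x)) D := by
  simp only [dotProduct_mulVec_eq_sum]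
  exact integrable_finsetSum _ fun i _ => integrable_finsetSum _ fun j _ =>
    (IsInitialLaw.integrable_mul hD i j).const_mul _

theorem IsInitialLaw.integral_form (hD : IsInitialLaw D Sigma0 Cm)
    (X : Matrix (Fin n) (Fin n) ℝ) :
    ∫ x, x ⬝ᵥ (X *ᵥ x) ∂D = ∑ i, ∑ j, X i j * Sigma0 i j := by
  simp only [dotProduct_mulVec_eq_sum]
  refine (integral_finsetSum _ fun i _ => integrable_finsetSum _ fun j _ =>
    (IsInitialLaw.integrable_mul hD i j).const_mul _).trans ?_
  refine Finset.sum_congr rfl fun i _ => ?_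
  refine (integral_finsetSum _ fun j _ =>
    (IsInitialLaw.integrable_mul hD i j).const_mul _).trans ?_
  refine Finset.sum_congr rfl fun j _ => ?_
  rw [integral_const_mul, hD.covariance]

/-- A law with positive definite covariance is not carried by the kernel of a nonzero matrix. -/
theorem IsInitialLaw.eq_zero_of_ae_mulVec_eq_zero (hD : IsInitialLaw D Sigma0 Cm)
    (hS : Sigma0.PosDef) {X : Matrix (Fin m) (Fin n) ℝ} (h : ∀ᵐ x ∂D, X *ᵥ x = 0) : X = 0 := by
  have hrow : ∀ i, X i = 0 := by
    intro i
    by_contra hi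
    -- For a row `v`, the form of `v vᵀ` is `(v·x)²`, with expectation `vᵀ Σ₀ v`: zero by `h`,
    -- positive if `v ≠ 0`.
    have h1 := IsInitialLaw.integral_form hD (Matrix.vecMulVec (X i) (X i))
    have h2 : ∫ x, x ⬝ᵥ (Matrix.vecMulVec (X i) (X i) *ᵥ x) ∂D = 0 := by
      refine integral_eq_zero_of_ae ?_
      filter_upwards [h] with x hx
      have hxi : X i ⬝ᵥ x = 0 := congrFun hx i
      simp [Matrix.vecMulVec_mulVec, hxi]
    have h3 := PosDef.pos hS hi
    rw [dotProduct_mulVec_eq_sum] at h3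
    rw [h2] at h1
    simp only [Matrix.vecMulVec_apply] at h1
    have h4 : ∀ i' j, Sigma0 i' j * (X i i' * X i j) = X i i' * X i j * Sigma0 i' j :=
      fun _ _ => by ring
    simp only [h4] at h3
    linarith
  funext i
  exact hrow i

/-- The excess cost over the Riccati gain is the expectation of the nonnegative form `(Ex)ᵀ (R +
BᵀPB) (Ex)`. Minimality makes it vanish, so `Ex = 0` almost surely, and the covariance forces `E =
0`. -/
theorem IsOptimalGain.eq_gain (hD : IsInitialLaw D Sigma0 Cm) (hS : Sigma0.PosDef)
    (hR : S.R.PosDef) {N h : ℕ} (hh : h < N) {K : ℕ → Matrix (Fin m) (Fin n) ℝ}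
    (hP : (S.costToGo K (h + 1) (N - (h + 1))).PosSemidef) {L : Matrix (Fin m) (Fin n) ℝ}
    (hL : S.IsOptimalGain D N K h L) :
    L = S.gain (S.costToGo K (h + 1) (N - (h + 1))) := by
  set P := S.costToGo K (h + 1) (N - (h + 1)) with hPdef
  have hle := isMinOn_univ_iff.mp hL (S.gain P)
  simp only [stageCost, S.pathCost_update hh, ← hPdef] at hle
  set E := L - S.gain P with hE
  have hsplit : ∀ x : Fin n → ℝ, (E *ᵥ x) ⬝ᵥ (S.hess P *ᵥ (E *ᵥ x)) =
      x ⬝ᵥ (S.costStep P L *ᵥ x) - x ⬝ᵥ (S.costStep P (S.gain P) *ᵥ x) := by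
    intro x
    rw [← dotProduct_sub, ← Matrix.sub_mulVec, costStep_sub_costStep_gain hR hP,
      dotProduct_congr_mulVec]
  have hM := hess_posDef hR hP
  have hint : ∫ x, (E *ᵥ x) ⬝ᵥ (S.hess P *ᵥ (E *ᵥ x)) ∂D ≤ 0 := by
    simp only [hsplit]
    rw [integral_sub (IsInitialLaw.integrable_form hD _) (IsInitialLaw.integrable_form hD _)]
    linarith
  have hnn : ∀ x : Fin n → ℝ, 0 ≤ (E *ᵥ x) ⬝ᵥ (S.hess P *ᵥ (E *ᵥ x)) :=
    fun x => PosSemidef.nonneg hM.posSemidef _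
  have hintegrable : Integrable (fun x => (E *ᵥ x) ⬝ᵥ (S.hess P *ᵥ (E *ᵥ x))) D := by
    simp only [← dotProduct_congr_mulVec]
    exact IsInitialLaw.integrable_form hD _
  have hae := (integral_eq_zero_iff_of_nonneg hnn hintegrable).mp
    (le_antisymm hint (integral_nonneg hnn))
  refine sub_eq_zero.mp (IsInitialLaw.eq_zero_of_ae_mulVec_eq_zero hD hS (X := E) ?_)
  filter_upwards [hae] with x hx
  by_contra hne
  exact (PosDef.pos hM hne).ne' hx

end Optimality

end Data


namespace Data

variable {n m : ℕ} {S : Data n m}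

/-! ### Perturbation bounds for one Riccati step -/

section Perturbation

variable {P P' : Matrix (Fin n) (Fin n) ℝ}

theorem norm_inv_hess_le (hR : S.R.PosDef) (hl : 0 < lambdaMin S.R) (hP : P.PosSemidef) :
    ‖(S.hess P)⁻¹‖ ≤ (lambdaMin S.R)⁻¹ := by
  refine norm_inv_le_of_coercive hl (hess_isUnit_det hR hP) fun x => ?_
  refine (lambdaMin_mul_le hR.isHermitian x).trans (PosSemidef.dotProduct_le ?_ x)
  rw [hess, add_sub_cancel_left]
  exact PosSemidef.transpose_mul_mul_same hP S.B

theorem norm_gain_sub_gain_le (hR : S.R.PosDef) (hl : 0 < lambdaMin S.R) (hP : P.PosSemidef)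
    (hP' : P'.PosSemidef) : ‖S.gain P - S.gain P'‖ ≤
      ‖S.B‖ / lambdaMin S.R * (‖P - P'‖ * ‖S.A - S.B * S.gain P'‖) := by
  rw [gain_sub_gain hR hP hP', div_eq_inv_mul, mul_assoc, ← mul_assoc ‖S.B‖]
  refine (Matrix.l2_opNorm_mul _ _).trans (mul_le_mul (norm_inv_hess_le hR hl hP) ?_
    (norm_nonneg _) (inv_nonneg.mpr hl.le))
  refine (Matrix.l2_opNorm_mul _ _).trans (mul_le_mul_of_nonneg_right ?_ (norm_nonneg _))
  refine (Matrix.l2_opNorm_mul _ _).trans_eq ?_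
  rw [norm_transpose]

theorem norm_closedLoop_le (hR : S.R.PosDef) (hl : 0 < lambdaMin S.R) (hP : P.PosSemidef)
    {c : ℝ} (hc : ‖P‖ ≤ c) :
    ‖S.A - S.B * S.gain P‖ ≤ ‖S.A‖ * (1 + c * ‖S.B‖ ^ 2 / lambdaMin S.R) := by
  have hc0 : 0 ≤ c := (norm_nonneg _).trans hc
  have h1 : ‖S.A - S.B * S.gain P‖ ≤ ‖S.A‖ + ‖S.B * (S.hess P)⁻¹ * S.Bᵀ * P‖ * ‖S.A‖ := by
    rw [sub_mul_gain, Matrix.sub_mul, Matrix.one_mul]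
    exact (norm_sub_le _ _).trans (by gcongr; exact Matrix.l2_opNorm_mul _ _)
  have h2 : ‖S.B * (S.hess P)⁻¹ * S.Bᵀ * P‖ ≤ ‖S.B‖ * (lambdaMin S.R)⁻¹ * ‖S.B‖ * c := by
    refine (Matrix.l2_opNorm_mul _ _).trans (mul_le_mul ?_ hc (norm_nonneg _) (by positivity))
    refine (Matrix.l2_opNorm_mul _ _).trans
      (mul_le_mul ?_ (norm_transpose _).le (norm_nonneg _) (by positivity))
    refine (Matrix.l2_opNorm_mul _ _).trans ?_
    gcongr
    exact norm_inv_hess_le hR hl hP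
  calc ‖S.A - S.B * S.gain P‖
      ≤ ‖S.A‖ + ‖S.B * (S.hess P)⁻¹ * S.Bᵀ * P‖ * ‖S.A‖ := h1
    _ ≤ ‖S.A‖ + ‖S.B‖ * (lambdaMin S.R)⁻¹ * ‖S.B‖ * c * ‖S.A‖ := by gcongr
    _ = _ := by ring

/-- Perturbation of one step of the Riccati recursion: the step started at the perturbed cost
matrix `P` and taken with a suboptimal gain `L`, against the exact step from `P'`. -/
theorem norm_costStep_sub_le (hR : S.R.PosDef) (hl : 0 < lambdaMin S.R) (hP : P.PosSemidef)
    (hP' : P'.PosSemidef) {T : Matrix (Fin n) (Fin n) ℝ}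
    (hT : ∀ x, x ⬝ᵥ (P *ᵥ x) ≤ x ⬝ᵥ (T *ᵥ x)) (L : Matrix (Fin m) (Fin n) ℝ) :
    ‖S.costStep P L - S.costStep P' (S.gain P')‖ ≤
      ‖S.A - S.B * S.gain P'‖ * ‖S.A‖ * (1 + ‖T‖ * ‖S.B‖ ^ 2 / lambdaMin S.R) * ‖P - P'‖
        + ‖S.R + S.Bᵀ * T * S.B‖ * ‖L - S.gain P‖ ^ 2 := by
  have hPT : ‖P‖ ≤ ‖T‖ := PosSemidef.norm_le_norm hP hT
  have hH : ‖S.hess P‖ ≤ ‖S.R + S.Bᵀ * T * S.B‖ := by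
    refine PosSemidef.norm_le_norm (hess_posDef hR hP).posSemidef fun x => ?_
    rw [hess, Matrix.add_mulVec, Matrix.add_mulVec, dotProduct_add, dotProduct_add,
      dotProduct_congr_mulVec, dotProduct_congr_mulVec]
    exact add_le_add le_rfl (hT _)
  -- Insert the exact step from `P`: one difference is quadratic in the gain error, the other linear
  -- in `P - P'`.
  rw [← sub_add_sub_cancel _ (S.costStep P (S.gain P)), costStep_sub_costStep_gain hR hP,
    costStep_gain_sub hR hP hP', add_comm]
  refine (norm_add_le _ _).trans (add_le_add ?_ ?_)
  · calc _ ≤ ‖(S.A - S.B * S.gain P)ᵀ‖ * ‖P - P'‖ * ‖S.A - S.B * S.gain P'‖ :=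
          (Matrix.l2_opNorm_mul _ _).trans
            (mul_le_mul_of_nonneg_right (Matrix.l2_opNorm_mul _ _) (norm_nonneg _))
      _ ≤ ‖S.A‖ * (1 + ‖T‖ * ‖S.B‖ ^ 2 / lambdaMin S.R) * ‖P - P'‖
            * ‖S.A - S.B * S.gain P'‖ := by
          rw [norm_transpose]
          gcongr
          exact norm_closedLoop_le hR hl hP hPT
      _ = _ := by ring
  · calc _ ≤ ‖(L - S.gain P)ᵀ‖ * ‖S.hess P‖ * ‖L - S.gain P‖ :=
          (Matrix.l2_opNorm_mul _ _).trans
            (mul_le_mul_of_nonneg_right (Matrix.l2_opNorm_mul _ _) (norm_nonneg _))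
      _ ≤ ‖L - S.gain P‖ * ‖S.R + S.Bᵀ * T * S.B‖ * ‖L - S.gain P‖ := by
          rw [norm_transpose]
          gcongr
      _ = _ := by ring

end Perturbation

/-! ### Convergence of the Riccati recursion to the stationary solution -/

section Recursion

variable {K : ℕ → Matrix (Fin m) (Fin n) ℝ} {N : ℕ}

theorem costToGo_eq_costStep {h : ℕ} (hh : h < N) (K : ℕ → Matrix (Fin m) (Fin n) ℝ) :
    S.costToGo K h (N - h) = S.costStep (S.costToGo K (h + 1) (N - (h + 1))) (K h) := by
  obtain ⟨k, rfl⟩ : ∃ k, N = h + 1 + k := ⟨N - (h + 1), by omega⟩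
  rw [show h + 1 + k - h = k + 1 by omega, show h + 1 + k - (h + 1) = k by omega, costToGo,
    costStep]

variable {Pstar : Matrix (Fin n) (Fin n) ℝ}

/-- Along the Riccati recursion the distance to the stationary solution `P*` stays positive
semidefinite and is dominated by the closed-loop Lyapunov recursion. -/
theorem costToGo_sub_bounds (hQ : S.Q.PosSemidef) (hR : S.R.PosDef) (hPstar : Pstar.PosSemidef)
    (hARE : S.IsARESolution Pstar) (hQN : (S.QN - Pstar).PosSemidef) (hN : S.QN.PosSemidef)
    (hK : ∀ h < N, K h = S.gain (S.costToGo K (h + 1) (N - (h + 1)))) (k t : ℕ) (hkt : t + k = N) :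
    (S.costToGo K t (N - t) - Pstar).PosSemidef ∧
    ∀ x, x ⬝ᵥ ((S.costToGo K t (N - t) - Pstar) *ᵥ x) ≤
      (((S.A - S.B * S.gain Pstar) ^ k) *ᵥ x) ⬝ᵥ
        ((S.QN - Pstar) *ᵥ (((S.A - S.B * S.gain Pstar) ^ k) *ᵥ x)) := by
  induction k generalizing t with
  | zero =>
    obtain rfl : t = N := by omega
    simpa [costToGo] using hQN
  | succ k ih =>
    obtain ⟨ih1, ih2⟩ := ih (t + 1) (by omega)
    have hP := costToGo_posSemidef hQ hR.posSemidef hN K (t + 1) (N - (t + 1))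
    rw [costToGo_eq_costStep (by omega), hK t (by omega)]
    set P := S.costToGo K (t + 1) (N - (t + 1))
    have hfix := IsARESolution.costStep_eq hR hPstar hARE
    constructor
    · have := costStep_gain_mono hR hPstar ih1
      rwa [hfix] at this
    · intro x
      -- Replacing the optimal gain by the suboptimal `K*` only increases the form and makes the
      -- recursion linear.
      have h1 := PosSemidef.dotProduct_le (X := S.costStep P (S.gain P) - Pstar)
        (Y := S.costStep P (S.gain Pstar) - Pstar)
        (by simpa using costStep_gain_le hR hP (S.gain Pstar)) x
      refine h1.trans ?_
      have h2 := costStep_sub_costStep (S := S) (P := P) (P' := Pstar) (S.gain Pstar)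
      rw [hfix] at h2
      rw [h2, dotProduct_congr_mulVec, pow_succ, ← Matrix.mulVec_mulVec]
      exact ih2 _

/-- `‖P*⁻¹‖` is the price of passing to the `P*`-form, where the closed loop contracts, and `‖P*‖`
that of returning; their product is the condition number. -/
theorem norm_costToGo_sub_le (hQ : S.Q.PosSemidef) (hR : S.R.PosDef) (hPstar : Pstar.PosDef)
    (hARE : S.IsARESolution Pstar) (hQN : (S.QN - Pstar).PosSemidef) (hN : S.QN.PosSemidef)
    (hK : ∀ h < N, K h = S.gain (S.costToGo K (h + 1) (N - (h + 1)))) (k t : ℕ) (hkt : t + k = N) :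
    ‖S.costToGo K t (N - t) - Pstar‖ ≤ inducedNorm Pstar (S.QN - Pstar) * cond Pstar
      * inducedNorm Pstar (S.A - S.B * S.gain Pstar) ^ (2 * k) := by
  obtain ⟨h1, h2⟩ := costToGo_sub_bounds hQ hR hPstar.posSemidef hARE hQN hN hK k t hkt
  have hi := inducedNorm_nonneg Pstar (S.QN - Pstar)
  have hr := inducedNorm_nonneg Pstar (S.A - S.B * S.gain Pstar)
  have hκ : 0 ≤ cond Pstar := mul_nonneg (norm_nonneg _) (norm_nonneg _)
  refine PosSemidef.norm_le h1 (by positivity) fun x => (h2 x).trans ?_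
  have h3 := pow_mulVec_le_inducedNorm hPstar (S.A - S.B * S.gain Pstar) k x
  generalize ((S.A - S.B * S.gain Pstar) ^ k) *ᵥ x = y at h3 ⊢
  generalize inducedNorm Pstar (S.A - S.B * S.gain Pstar) = r at h3 hr ⊢
  have h4 := dotProduct_mulVec_le_inducedNorm_mul hPstar (S.QN - Pstar) y
  generalize inducedNorm Pstar (S.QN - Pstar) = w at h4 hi ⊢
  calc _ ≤ w * ‖Pstar⁻¹‖ * (y ⬝ᵥ (Pstar *ᵥ y)) := h4
    _ ≤ w * ‖Pstar⁻¹‖ * (r ^ (2 * k) * (‖Pstar‖ * (x ⬝ᵥ x))) := by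
        refine mul_le_mul_of_nonneg_left (h3.trans ?_) (by positivity)
        exact mul_le_mul_of_nonneg_left (dotProduct_mulVec_le _ _) (by positivity)
    _ = _ := by unfold cond; ring

theorem inducedNorm_closedLoop_lt_one (hQ : S.Q.PosDef) (hR : S.R.PosDef) (hPstar : Pstar.PosDef)
    (hARE : S.IsARESolution Pstar) :
    inducedNorm Pstar (S.A - S.B * S.gain Pstar) < 1 := by
  refine inducedNorm_lt_one hPstar hQ fun z => ?_
  have hfix := IsARESolution.costStep_eq hR hPstar.posSemidef hARE
  have h1 : z ⬝ᵥ (Pstar *ᵥ z) = z ⬝ᵥ (S.costStep Pstar (S.gain Pstar) *ᵥ z) := by rw [hfix]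
  rw [costStep, Matrix.add_mulVec, Matrix.add_mulVec, dotProduct_add, dotProduct_add,
    dotProduct_congr_mulVec, dotProduct_congr_mulVec] at h1
  have h2 := PosSemidef.nonneg hR.posSemidef (S.gain Pstar *ᵥ z)
  linarith

theorem eq_zero_of_inducedNorm_eq_zero {W X : Matrix (Fin n) (Fin n) ℝ} (hW : W.PosDef)
    (h : inducedNorm W X = 0) : X = 0 := by
  refine norm_le_zero_iff.mp (norm_le_of_mulVec_dotProduct_self_le X le_rfl fun x => ?_)
  have h1 := dotProduct_mulVec_le_inducedNorm hW X x
  have h2 := PosDef.dotProduct_self_le hW (X *ᵥ x)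
  rw [h] at h1
  nlinarith [norm_nonneg W⁻¹]

theorem pow_mul_le_one_of_log_le {r c : ℝ} (hr : 0 < r) (hr1 : r < 1) (hc : 0 < c) (hN1 : 1 ≤ N)
    (h : 1 / 2 * (Real.log c / Real.log (1 / r)) + 1 ≤ N) : r ^ (2 * (N - 1)) * c ≤ 1 := by
  have hlog : 0 < Real.log (1 / r) := Real.log_pos (by rw [lt_div_iff₀ hr]; linarith)
  have h1 : Real.log c / Real.log (1 / r) ≤ 2 * (N - 1) := by linarith
  rw [div_le_iff₀ hlog, one_div, Real.log_inv] at h1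
  have h2 : Real.log (r ^ (2 * (N - 1)) * c) ≤ 0 := by
    rw [Real.log_mul (by positivity) hc.ne', Real.log_pow]
    push_cast [Nat.cast_sub hN1]
    linarith
  exact (Real.log_nonpos_iff (by positivity)).mp h2

theorem norm_gain_costToGo_sub_gain_le (hQ : S.Q.PosDef) (hR : S.R.PosDef)
    (hl : 0 < lambdaMin S.R) (hPstar : Pstar.PosDef) (hARE : S.IsARESolution Pstar)
    (hQN : (S.QN - Pstar).PosSemidef) (hN : S.QN.PosSemidef)
    (hK : ∀ h < N, K h = S.gain (S.costToGo K (h + 1) (N - (h + 1))))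
    {ε : ℝ} (hε : 0 < ε) (hN1 : 1 ≤ N) (hhor : S.horizon Pstar ε ≤ N) :
    ‖S.gain (S.costToGo K 1 (N - 1)) - S.gain Pstar‖ ≤ ε / 2 := by
  have hP1 := norm_costToGo_sub_le hQ.posSemidef hR hPstar hARE hQN hN hK (N - 1) 1 (by omega)
  have hG := norm_gain_sub_gain_le hR hl
    (costToGo_posSemidef hQ.posSemidef hR.posSemidef hN K 1 (N - 1)) hPstar.posSemidef
  have hr0 := inducedNorm_nonneg Pstar (S.A - S.B * S.gain Pstar)
  have hr1 := inducedNorm_closedLoop_lt_one hQ hR hPstar hARE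
  have hw := inducedNorm_nonneg Pstar (S.QN - Pstar)
  have hκ : 0 ≤ cond Pstar := mul_nonneg (norm_nonneg _) (norm_nonneg _)
  have hrA : inducedNorm Pstar (S.A - S.B * S.gain Pstar) = 0 →
      ‖S.A - S.B * S.gain Pstar‖ = 0 := fun h => by
    rw [eq_zero_of_inducedNorm_eq_zero hPstar h, norm_zero]
  unfold horizon at hhor
  generalize ‖S.costToGo K 1 (N - 1) - Pstar‖ = p at hP1 hG
  generalize ‖S.gain (S.costToGo K 1 (N - 1)) - S.gain Pstar‖ = g at hG ⊢
  generalize inducedNorm Pstar (S.A - S.B * S.gain Pstar) = r at *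
  generalize inducedNorm Pstar (S.QN - Pstar) = w at *
  generalize cond Pstar = κ at *
  have hα := norm_nonneg (S.A - S.B * S.gain Pstar)
  generalize ‖S.A - S.B * S.gain Pstar‖ = α at *
  have hb := norm_nonneg S.B
  generalize ‖S.B‖ = b at *
  generalize lambdaMin S.R = l at *
  clear hK
  have hbound : g ≤ ε / 2 * (r ^ (2 * (N - 1)) * (2 * w * κ * α * b / (ε * l))) := by
    calc g ≤ b / l * (p * α) := hG
      _ ≤ b / l * (w * κ * r ^ (2 * (N - 1)) * α) := by gcongr
      _ = _ := by field_simp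
  have hc : 0 ≤ 2 * w * κ * α * b / (ε * l) := by positivity
  refine hbound.trans ?_
  suffices r ^ (2 * (N - 1)) * (2 * w * κ * α * b / (ε * l)) ≤ 1 by nlinarith
  -- If the argument of the logarithm is zero, the bound is trivial; the horizon condition serves
  -- only the other case.
  rcases hc.eq_or_lt with hc | hc
  · rw [← hc]; simp
  -- A zero contraction factor means `A - B K* = 0`, contradicting the positive argument.
  rcases hr0.eq_or_lt with hr0 | hr0
  · rw [hrA hr0.symm] at hc
    simp at hc
  · exact pow_mul_le_one_of_log_le hr0 hr1 hc hN1 hhor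

end Recursion

/-! ### Backward propagation of the gain errors -/

section ErrorPropagation

variable {N : ℕ} {Kstar Ktil KtilStar : ℕ → Matrix (Fin m) (Fin n) ℝ} {ε : ℝ}

theorem a_nonneg (S : Data n m) : 0 ≤ S.a := by unfold a sigmaMin; positivity

theorem phi_nonneg (S : Data n m) (N : ℕ) (K : ℕ → Matrix (Fin m) (Fin n) ℝ) : 0 ≤ S.phi N K :=
  Real.iSup_nonneg fun _ => norm_nonneg _

theorem norm_le_phi (K : ℕ → Matrix (Fin m) (Fin n) ℝ) {h : ℕ} (hh : h < N) :
    ‖S.A - S.B * K h‖ ≤ S.phi N K :=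
  le_ciSup (f := fun t : Fin N => ‖S.A - S.B * K t‖) (Set.finite_range _).bddAbove ⟨h, hh⟩

theorem C₁_nonneg (hl : 0 < lambdaMin S.R) (K : ℕ → Matrix (Fin m) (Fin n) ℝ) :
    0 ≤ S.C₁ N K := by
  have := S.phi_nonneg N K
  unfold C₁; positivity

theorem C₂_nonneg (hl : 0 < lambdaMin S.R) (K : ℕ → Matrix (Fin m) (Fin n) ℝ) :
    0 ≤ S.C₂ N K := by
  have := S.phi_nonneg N K
  unfold C₂; positivity

theorem C₃_nonneg (S : Data n m) : 0 ≤ S.C₃ := by unfold C₃; positivity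

theorem mul_sq_le_of_le_sqrt_div {x y d : ℝ} (hx : 0 ≤ x) (hy : 0 ≤ y) (hd : 0 ≤ d)
    (h : d ≤ √(x / y)) : y * d ^ 2 ≤ x := by
  -- A vanishing denominator makes the claim `0 ≤ x`, so degenerate constants do no harm.
  rcases hy.eq_or_lt with rfl | hy
  · simpa using hx
  · have := pow_le_pow_left₀ hd h 2
    rwa [Real.sq_sqrt (by positivity), le_div_iff₀ hy, mul_comm] at this

theorem mul_sq_le_of_le_half_sqrt_div {x y d : ℝ} (hx : 0 ≤ x) (hy : 0 ≤ y) (hd : 0 ≤ d)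
    (h : d ≤ 1 / 2 * √(x / y)) : 4 * y * d ^ 2 ≤ x := by
  have := mul_sq_le_of_le_sqrt_div hx hy (d := 2 * d) (by positivity) (by linarith)
  linarith

/-- One backward step of the error recursion. -/
theorem norm_costToGo_sub_costToGo_le (hQ : S.Q.PosSemidef) (hR : S.R.PosDef)
    (hl : 0 < lambdaMin S.R) (hQN : S.QN.PosSemidef)
    (hQNmax : ∀ t, 1 ≤ t → t ≤ N → (S.QN - S.costToGo Kstar t (N - t)).PosSemidef)
    (hK : ∀ h < N, Kstar h = S.gain (S.costToGo Kstar (h + 1) (N - (h + 1))))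
    {h : ℕ} (hh : h < N)
    (he : ‖S.costToGo Ktil (h + 1) (N - (h + 1)) - S.costToGo Kstar (h + 1) (N - (h + 1))‖
      ≤ S.a) :
    ‖S.costToGo Ktil h (N - h) - S.costToGo Kstar h (N - h)‖ ≤
      S.C₂ N Kstar / 2 *
        ‖S.costToGo Ktil (h + 1) (N - (h + 1)) - S.costToGo Kstar (h + 1) (N - (h + 1))‖
      + S.C₃ / 2 * ‖Ktil h - S.gain (S.costToGo Ktil (h + 1) (N - (h + 1)))‖ ^ 2 := by
  have hmax := hQNmax (h + 1) (by omega) (by omega)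
  have hφ := norm_le_phi (S := S) Kstar hh
  have hPt := costToGo_posSemidef hQ hR.posSemidef hQN Ktil (h + 1) (N - (h + 1))
  have hPs := costToGo_posSemidef hQ hR.posSemidef hQN Kstar (h + 1) (N - (h + 1))
  rw [costToGo_eq_costStep hh Ktil, costToGo_eq_costStep hh Kstar]
  rw [hK h hh] at hφ ⊢
  set Pt := S.costToGo Ktil (h + 1) (N - (h + 1))
  set Ps := S.costToGo Kstar (h + 1) (N - (h + 1))
  -- An error of at most `a` gives `P̃ ⪯ P*_{h+1} + aI ⪯ Q_N + aI`, which makes `C₂` and `C₃`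
  -- uniform in the stage.
  have hT : ∀ x, x ⬝ᵥ (Pt *ᵥ x) ≤
      x ⬝ᵥ ((S.QN + S.a • (1 : Matrix (Fin n) (Fin n) ℝ)) *ᵥ x) := by
    intro x
    have h1 := PosSemidef.dotProduct_le hmax x
    have h2 := dotProduct_mulVec_le (Pt - Ps) x
    have h3 := mul_le_mul_of_nonneg_right he (dotProduct_self_nonneg' x)
    rw [Matrix.sub_mulVec, dotProduct_sub] at h2
    rw [Matrix.add_mulVec, Matrix.smul_mulVec, Matrix.one_mulVec, dotProduct_add, dotProduct_smul,
      smul_eq_mul]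
    linarith
  refine (norm_costStep_sub_le hR hl hPt hPs hT (Ktil h)).trans (add_le_add ?_ (le_of_eq ?_))
  · calc _ ≤ S.phi N Kstar * ‖S.A‖ * (1 + ‖S.QN + S.a • (1 : Matrix (Fin n) (Fin n) ℝ)‖
            * ‖S.B‖ ^ 2 / lambdaMin S.R) * ‖Pt - Ps‖ := by gcongr
      _ = _ := by unfold C₂; ring
  · unfold C₃; ring

/-- The three bounds, at stage `h = j + 2`, form one backward invariant. The first licenses the next
recursion step, the second keeps the first alive when `C₂ > 1`, and the third is the accuracy
target. In the weighted bounds the factor `C₂/2` uses half of the inherited bound and the tolerance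
supplies the other half. -/
theorem error_bounds (hQ : S.Q.PosSemidef) (hR : S.R.PosDef)
    (hl : 0 < lambdaMin S.R) (hQN : S.QN.PosSemidef) (hε : 0 < ε)
    (hQNmax : ∀ t, 1 ≤ t → t ≤ N → (S.QN - S.costToGo Kstar t (N - t)).PosSemidef)
    (hK : ∀ h < N, Kstar h = S.gain (S.costToGo Kstar (h + 1) (N - (h + 1))))
    (hTol : ∀ h < N, ‖Ktil h - S.gain (S.costToGo Ktil (h + 1) (N - (h + 1)))‖
      ≤ S.stageTol N Kstar ε h) (k j : ℕ) (hkj : j + 2 + k = N) :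
    ‖S.costToGo Ktil (j + 2) (N - (j + 2)) - S.costToGo Kstar (j + 2) (N - (j + 2))‖ ≤ S.a ∧
    S.C₂ N Kstar ^ j *
      ‖S.costToGo Ktil (j + 2) (N - (j + 2)) - S.costToGo Kstar (j + 2) (N - (j + 2))‖ ≤ S.a ∧
    4 * (S.C₁ N Kstar * S.C₂ N Kstar ^ (j + 1)) *
      ‖S.costToGo Ktil (j + 2) (N - (j + 2)) - S.costToGo Kstar (j + 2) (N - (j + 2))‖ ≤ ε := by
  have ha := S.a_nonneg
  have h1 := C₁_nonneg (N := N) hl Kstar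
  have h2 := C₂_nonneg (N := N) hl Kstar
  have h3 := S.C₃_nonneg
  induction k generalizing j with
  | zero =>
    subst hkj
    simp only [add_zero, Nat.sub_self, costToGo, sub_self, norm_zero, mul_zero]
    exact ⟨ha, ha, hε.le⟩
  | succ k ih =>
    obtain ⟨ih1, ih2, ih3⟩ := ih (j + 1) (by omega)
    have hstep := norm_costToGo_sub_costToGo_le (h := j + 2) (Ktil := Ktil) hQ hR hl hQN hQNmax hK
      (by omega) ih1
    have htol := hTol (j + 2) (by omega)
    rw [stageTol, le_min_iff, le_min_iff] at htol
    obtain ⟨t1, t2, t3⟩ := htol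
    have hd := norm_nonneg (Ktil (j + 2) - S.gain (S.costToGo Ktil (j + 2 + 1) (N - (j + 2 + 1))))
    have t1 := mul_sq_le_of_le_sqrt_div ha h3 hd t1
    have t2 := mul_sq_le_of_le_sqrt_div ha (by positivity) hd t2
    have t3 := mul_sq_le_of_le_half_sqrt_div hε.le (by positivity) hd t3
    rw [show j + 1 + 2 = j + 2 + 1 by ring] at ih1 ih2 ih3
    set d := ‖Ktil (j + 2) - S.gain (S.costToGo Ktil (j + 2 + 1) (N - (j + 2 + 1)))‖
    set e' := ‖S.costToGo Ktil (j + 2 + 1) (N - (j + 2 + 1))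
      - S.costToGo Kstar (j + 2 + 1) (N - (j + 2 + 1))‖ with he'
    set e := ‖S.costToGo Ktil (j + 2) (N - (j + 2)) - S.costToGo Kstar (j + 2) (N - (j + 2))‖
      with he
    have he0 : 0 ≤ e := norm_nonneg _
    have he0' : 0 ≤ e' := norm_nonneg _
    have hA : S.C₂ N Kstar ^ j * e ≤ S.a := by
      have := mul_le_mul_of_nonneg_left hstep (pow_nonneg h2 j)
      rw [pow_succ] at ih2
      nlinarith
    refine ⟨?_, hA, ?_⟩
    -- For `C₂ ≤ 1` the recursion itself gives `a/2 + a/2`; for `C₂ ≥ 1` the weighted bound is the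
    -- stronger one.
    · rcases le_total (S.C₂ N Kstar) 1 with hle | hle
      · nlinarith
      · nlinarith [one_le_pow₀ hle (n := j)]
    · have := mul_le_mul_of_nonneg_left hstep
        (show 0 ≤ 4 * (S.C₁ N Kstar * S.C₂ N Kstar ^ (j + 1)) by positivity)
      rw [pow_succ _ (j + 1)] at ih3
      nlinarith

theorem error_bound_one (hQ : S.Q.PosSemidef) (hR : S.R.PosDef)
    (hl : 0 < lambdaMin S.R) (hQN : S.QN.PosSemidef) (hε : 0 < ε) (hN1 : 1 ≤ N)
    (hQNmax : ∀ t, 1 ≤ t → t ≤ N → (S.QN - S.costToGo Kstar t (N - t)).PosSemidef)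
    (hK : ∀ h < N, Kstar h = S.gain (S.costToGo Kstar (h + 1) (N - (h + 1))))
    (hTol : ∀ h < N, ‖Ktil h - S.gain (S.costToGo Ktil (h + 1) (N - (h + 1)))‖
      ≤ S.stageTol N Kstar ε h) :
    4 * S.C₁ N Kstar * ‖S.costToGo Ktil 1 (N - 1) - S.costToGo Kstar 1 (N - 1)‖ ≤ ε := by
  -- For `N = 1` both cost matrices equal `Q_N`, so the error is zero.
  rcases hN1.eq_or_lt with rfl | hN2
  · simpa [costToGo] using hε.le
  obtain ⟨e1, -, e3⟩ := error_bounds hQ hR hl hQN hε hQNmax hK hTol (N - 2) 0 (by omega)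
  have hstep := norm_costToGo_sub_costToGo_le (h := 1) (Ktil := Ktil) hQ hR hl hQN hQNmax hK hN2 e1
  have htol := hTol 1 hN2
  rw [stageTol, le_min_iff] at htol
  have h1 := C₁_nonneg (N := N) hl Kstar
  have h3 := S.C₃_nonneg
  have t2 := mul_sq_le_of_le_half_sqrt_div hε.le (by positivity) (norm_nonneg _) htol.2
  have := mul_le_mul_of_nonneg_left hstep (show 0 ≤ 4 * S.C₁ N Kstar by positivity)
  simp only [zero_add, pow_one, Nat.reduceAdd] at e3 this t2
  linarith

end ErrorPropagation

end Data

end LQR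

/-! ### Assembly of the three error contributions -/

theorem mainTheorem5 {n m : ℕ} (S : LQR.Data n m)
    (hQ : S.Q.PosDef) (hR : S.R.PosDef) (hStab : LQR.Stabilizable S.A S.B)
    -- the law of the initial state
    (D : MeasureTheory.Measure (Fin n → ℝ)) (Sigma0 : Matrix (Fin n) (Fin n) ℝ) (Cm : ℝ)
    (hSigma0 : Sigma0.PosDef) (hCm : 0 < Cm) (hD : LQR.IsInitialLaw D Sigma0 Cm)
    -- the positive definite solution of the algebraic Riccati equation
    (Pstar : Matrix (Fin n) (Fin n) ℝ) (hPstar : Pstar.PosDef) (hARE : S.IsARESolution Pstar)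
    -- accuracy and horizon
    (ε : ℝ) (hε : 0 < ε) (N : ℕ) (hN1 : 1 ≤ N) (hN : S.horizon Pstar ε ≤ (N : ℝ))
    -- the optimal gains of the true finite-horizon problem
    (Kstar : ℕ → Matrix (Fin m) (Fin n) ℝ)
    (hKstar : ∀ h < N, S.IsOptimalGain D N Kstar h (Kstar h))
    -- the terminal weight dominates `P*` and all Riccati iterates `P*_1, …, P*_N`
    (hQN : (S.QN - Pstar).PosSemidef)
    (hQNmax : ∀ t, 1 ≤ t → t ≤ N → (S.QN - S.costToGo Kstar t (N - t)).PosSemidef)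
    -- the computed gains and the optimal gains of the surrogate problems
    (Ktil KtilStar : ℕ → Matrix (Fin m) (Fin n) ℝ)
    (hKtilStar : ∀ h < N, S.IsOptimalGain D N Ktil h (KtilStar h))
    (hTol : ∀ h < N, ‖Ktil h - KtilStar h‖ ≤ S.stageTol N Kstar ε h) :
    ‖Ktil 0 - S.gain Pstar‖ ≤ ε := by
  -- Without inputs `lambdaMin S.R` is 0 rather than positive, but all gains coincide.
  rcases Nat.eq_zero_or_pos m with rfl | hm
  · rw [Subsingleton.elim (Ktil 0 - S.gain Pstar) 0, norm_zero]
    exact hε.le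
  have : NeZero m := ⟨hm.ne'⟩
  have hl := LQR.lambdaMin_pos hR
  have hQNpsd : S.QN.PosSemidef := by simpa using hQN.add hPstar.posSemidef
  have hpsd := LQR.Data.costToGo_posSemidef hQ.posSemidef hR.posSemidef hQNpsd
  have hK : ∀ h < N, Kstar h = S.gain (S.costToGo Kstar (h + 1) (N - (h + 1))) := fun h hh =>
    LQR.Data.IsOptimalGain.eq_gain hD hSigma0 hR hh (hpsd _ _ _) (hKstar h hh)
  have hKt : ∀ h < N, KtilStar h = S.gain (S.costToGo Ktil (h + 1) (N - (h + 1))) := fun h hh =>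
    LQR.Data.IsOptimalGain.eq_gain hD hSigma0 hR hh (hpsd _ _ _) (hKtilStar h hh)
  have hTol' : ∀ h < N, ‖Ktil h - S.gain (S.costToGo Ktil (h + 1) (N - (h + 1)))‖
      ≤ S.stageTol N Kstar ε h := fun h hh => by
    rw [← hKt h hh]
    exact hTol h hh
  have h0 : ‖Ktil 0 - S.gain (S.costToGo Ktil 1 (N - 1))‖ ≤ ε / 4 := hTol' 0 hN1
  have h1 : ‖S.gain (S.costToGo Ktil 1 (N - 1)) - S.gain (S.costToGo Kstar 1 (N - 1))‖
      ≤ ε / 4 := by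
    have herr := LQR.Data.error_bound_one hQ.posSemidef hR hl hQNpsd hε hN1 hQNmax hK hTol'
    have hφ := LQR.Data.norm_le_phi (S := S) Kstar hN1
    rw [hK 0 hN1] at hφ
    refine (LQR.Data.norm_gain_sub_gain_le hR hl (hpsd _ _ _) (hpsd _ _ _)).trans ?_
    calc _ ≤ ‖S.B‖ / LQR.lambdaMin S.R *
          (‖S.costToGo Ktil 1 (N - 1) - S.costToGo Kstar 1 (N - 1)‖ * S.phi N Kstar) := by
          gcongr
      _ = (4 * S.C₁ N Kstar *
          ‖S.costToGo Ktil 1 (N - 1) - S.costToGo Kstar 1 (N - 1)‖) / 4 := by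
          rw [LQR.Data.C₁]; ring
      _ ≤ ε / 4 := by linarith
  have h2 := LQR.Data.norm_gain_costToGo_sub_gain_le hQ hR hl hPstar hARE hQN hQNpsd hK hε hN1 hN
  have e1 := norm_sub_le_norm_sub_add_norm_sub (Ktil 0) (S.gain (S.costToGo Ktil 1 (N - 1)))
    (S.gain Pstar)
  have e2 := norm_sub_le_norm_sub_add_norm_sub (S.gain (S.costToGo Ktil 1 (N - 1)))
    (S.gain (S.costToGo Kstar 1 (N - 1))) (S.gain Pstar)
  linarith
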